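/- Local rate of convergence of quantile total variation denoising. Setting. Let $\tau\in(0,1)$ and $\rho_\tau(x)=\max\{\tau x,(\tau-1)x\}$. For $y\in\mathbb{R}^n$ and $\lambda>0$, a quantile TVD estimate is any minimizer $\hat\theta\in\mathbb{R}^n$ of $$\theta\mapsto\sum_{i=1}^n\rho_\tau(y_i-\theta_i)+\lambda\sum_{i=1}^{n-1}|\theta_{i+1}-\theta_i|.$$ Suppose $y_i=\theta^*_i+\epsilon_i$ with $\theta^*_i=f^*(i/n)$, $1\le i\le n$, for a function $f^*:\mathbb{R}\to\mathbb{R}$, where $\epsilon_1,\dots,\epsilon_n$ are independent (not necessarily identically distributed) random variables with $\tau$-th quantile $0$. Assume that there are $c_1,\delta>0$, independent of $n$, such that the distribution function $F_k$ of $\epsilon_k$ satisfies $c_1|t|\le|F_k(t)-\tau|$ for all $|t|\le\delta$ and all $k$. Let $x_0\in[0,1]$, $i_0=\max\{1,\lfloor nx_0\rfloor\}$, $r_0>0$, $\alpha_0>0$, and suppose that $|f^*(x)-f^*(y)|\le L_0|x-y|^{\alpha_0}$ for all $x,y\in\mathbf{I}$, where $\mathbf{I}\subseteq[0,1]$ is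 the interval $[x_0-r_0,x_0+r_0]$ if $0<x_0<1$, $[0,r_0]$ if $x_0=0$, and $[1-r_0,1]$ if $x_0=1$. Theorem. Let $c>1$. There are constants $C,C'>0$, depending only on $\tau,c_1,\delta,c$, a constant $C''>0$ that may depend in addition on $\alpha_0,L_0$, and a constant $C'''>0$ that may depend in addition on $r_0$, such that the following holds for all $n\ge N$, where $N$ depends on $\tau,c_1,\delta,c,x_0,r_0$ (and, in (A), on $\alpha_0,L_0$), but not on $f^*$, $\lambda$ or the distributions of the errors. (A) Let $\alpha_0\le1$ and $L_0>0$, and set $$B_n=\Big\lfloor L_0^{-\frac{2}{2\alpha_0+1}}n^{\frac{2\alpha_0}{2\alpha_0+1}}(\log n)^{\frac{1}{2\alpha_0+1}}\Big\rfloor.$$ For every $\lambda$ with $C\log n\le\lambda<C''n^{\frac{2\alpha_0}{2\alpha_0+1}}(\log n)^{\frac1{2\alpha_0+1}}$, with probability at least $1-4n^{-c}$, every quantile TVD estimate satisfies $$|\hat\theta_{i_0}-\theta^*_{i_0}|\le C'\Big(\frac{\log n}{\lambda}+\frac{\lambda}{B_n}\Big).$$ Moreover, $\lambda^*=(B_n\log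 n)^{1/2}$ is the unique minimizer of $\lambda\mapsto\frac{\log n}{\lambda}+\frac{\lambda}{B_n}$ over $\lambda>0$, it lies in the above range, and for $\lambda=\lambda^*$, with probability at least $1-4n^{-c}$, $$|\hat\theta_{i_0}-\theta^*_{i_0}|\le K(2\alpha_0L_0)^{\frac1{2\alpha_0+1}}n^{-\frac{\alpha_0}{2\alpha_0+1}}(\log n)^{\frac{\alpha_0}{2\alpha_0+1}}$$ for every quantile TVD estimate, where $K>0$ depends only on $\tau,c_1,\delta,c,\alpha_0$. (B) Let $\alpha_0>1$, that is, let $f^*$ be constant on $\mathbf{I}$. For every $\lambda$ with $C\log n\le\lambda<C'''n$, with probability at least $1-4n^{-c}$, every quantile TVD estimate satisfies $$|\hat\theta_{i_0}-\theta^*_{i_0}|\le C'\Big(\frac{\log n}{\lambda}+\frac{\lambda}{nr_0}\Big).$$ Moreover, $\lambda^*=(nr_0\log n)^{1/2}$ is the unique minimizer of $\lambda\mapsto\frac{\log n}{\lambda}+\frac{\lambda}{nr_0}$ over $\lambda>0$, it lies in the above range, and for $\lambda=\lambda^*$, with probability at least $1-4n^{-c}$, $|\hat\theta_{i_0}-\theta^*_{i_0}|\le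 K'(\log n/(nr_0))^{1/2}$ for every quantile TVD estimate, where $K'>0$ depends only on $\tau,c_1,\delta,c$. -/

import Mathlib

open MeasureTheory ProbabilityTheory Set
open scoped NNReal

noncomputable section

/-- The quantile (pinball) loss `ρ_τ`. -/
def pinball (τ x : ℝ) : ℝ := max (τ * x) ((τ - 1) * x)

/-- Total variation of a vector. The entry with index `i : Fin n` is the one at location `i + 1`. -/
def totalVar {n : ℕ} (θ : Fin n → ℝ) : ℝ :=
  ∑ i : Fin (n - 1), |θ ⟨(i : ℕ) + 1, by omega⟩ - θ ⟨(i : ℕ), by omega⟩|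

/-- The objective function of quantile total variation denoising. -/
def tvdObjective {n : ℕ} (τ lam : ℝ) (y θ : Fin n → ℝ) : ℝ :=
  ∑ i, pinball τ (y i - θ i) + lam * totalVar θ

/-- The set of all quantile TVD estimates for the data vector `y`: all global minimizers. -/
def quantileTVD {n : ℕ} (τ lam : ℝ) (y : Fin n → ℝ) : Set (Fin n → ℝ) :=
  {θ | ∀ θ' : Fin n → ℝ, tvdObjective τ lam y θ ≤ tvdObjective τ lam y θ'}

/-- `q` is a `τ`-th quantile of the law `μ`. -/
def IsQuantile (μ : Measure ℝ) (τ q : ℝ) : Prop :=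
  μ.real (Iio q) ≤ τ ∧ τ ≤ μ.real (Iic q)

/-- The errors of the quantile sequence model: independent random variables (not necessarily
identically distributed) with `τ`-th quantile equal to zero. -/
structure QuantileErrors {Ω : Type*} [MeasurableSpace Ω] (P : Measure Ω) (τ : ℝ) {n : ℕ}
    (ε : Fin n → Ω → ℝ) : Prop where
  measurable : ∀ k, Measurable (ε k)
  indep : iIndepFun ε P
  quantile : ∀ k, IsQuantile (P.map (ε k)) τ 0

/-- The distribution functions of the errors grow at least linearly around zero. -/
def CDFGrowth {Ω : Type*} [MeasurableSpace Ω] (P : Measure Ω) (τ c₁ δ : ℝ) {n : ℕ}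
    (ε : Fin n → Ω → ℝ) : Prop :=
  ∀ k, ∀ t : ℝ, |t| ≤ δ → c₁ * |t| ≤ |cdf (P.map (ε k)) t - τ|

/-- The signal vector: the values of `f` at the design points `1/n, 2/n, …, n/n`. -/
def signal (f : ℝ → ℝ) (n : ℕ) (i : Fin n) : ℝ := f ((((i : ℕ) : ℝ) + 1) / n)

/-- The interval of radius `r` attached to `x₀ ∈ [0, 1]`: two-sided at interior points,
one-sided at the two end points. -/
def localInterval (x₀ r : ℝ) : Set ℝ :=
  if x₀ = 0 then Icc 0 r else if x₀ = 1 then Icc (1 - r) 1 else Icc (x₀ - r) (x₀ + r)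

/-- `f` is Hölder continuous with exponent `α` and constant `L` on the interval of radius `r`
attached to `x₀`, and this interval is contained in `[0, 1]`. -/
def LocallyHolder (f : ℝ → ℝ) (x₀ r : ℝ) (α L : ℝ≥0) : Prop :=
  localInterval x₀ r ⊆ Icc 0 1 ∧ HolderOnWith L α f (localInterval x₀ r)

/-- The bandwidth `B_n`. -/
def bandwidth (α L : ℝ) (n : ℕ) : ℕ :=
  ⌊L ^ (-2 / (2 * α + 1)) * (n : ℝ) ^ (2 * α / (2 * α + 1)) *
    Real.log n ^ (1 / (2 * α + 1))⌋₊

/-- The bound `log n / λ + λ / B`. -/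
def riskBound (n : ℕ) (B lam : ℝ) : ℝ := Real.log n / lam + lam / B

/-- The tuning parameter `λ* = (B log n)^{1/2}`. -/
def lamStar (n : ℕ) (B : ℝ) : ℝ := Real.sqrt (B * Real.log n)

/-- `lamStar n B` is the unique minimizer of `riskBound n B` over all positive `λ`. -/
def LamStarOptimal (n : ℕ) (B : ℝ) : Prop :=
  0 < lamStar n B ∧
    ∀ lam : ℝ, 0 < lam → lam ≠ lamStar n B → riskBound n B (lamStar n B) < riskBound n B lam

/-- `E` has probability at least `p` (in the strong sense that it contains an event of
probability at least `p`, so that measurability of `E` is not an issue). -/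
def HoldsWithProb {Ω : Type*} [MeasurableSpace Ω] (P : Measure Ω) (p : ℝ) (E : Set Ω) : Prop :=
  ∃ A : Set Ω, MeasurableSet A ∧ A ⊆ E ∧ p ≤ P.real A

/-- For the data `y_k = f(k/n) + ε_k`, every quantile TVD estimate `θ` satisfies
`|θ_i - f(i/n)| ≤ b` at the location `i = max(1, ⌊n x₀⌋)`. -/
def errorAtMost {Ω : Type*} {n : ℕ} (τ lam : ℝ) (f : ℝ → ℝ) (ε : Fin n → Ω → ℝ)
    (x₀ b : ℝ) : Set Ω :=
  {ω | ∀ θ ∈ quantileTVD τ lam (fun k => signal f n k + ε k ω),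
    ∀ i : Fin n, (i : ℕ) + 1 = max 1 ⌊(n : ℝ) * x₀⌋₊ → |θ i - signal f n i| ≤ b}

end

/-! ### Local behaviour of quantile TVD estimates -/

/-! Fix a window of radius `h` around the location `i`, on which the signal varies by at most `b`,
and suppose that the estimate overshoots there by more than `b + u`. Lower the estimate slightly on
the run of its superlevel set at height `θ i` through `i`, cut off at the window. Each end of the
run saves one unit of penalty if the run stops by itself, costs at most one if the window cuts it,
and is free at the boundary of the data. Optimality then forces the quantile score `∑ (τ - 1{y k < θ
i})` over the run to be at least `lam`, or at least `-2 * lam` with the run of length at least `h`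
(`exists_interval_score`).

The overshoot makes the mean score at most `-c₁ * u` per point, and Hoeffding's inequality with a
union bound over all intervals keeps a score of `m` terms within order `(m log n)^{1/2}` of its mean
(`measureReal_compl_intervalEvent_le`). With `u` a large multiple of `log n / lam + lam / h` the two
facts contradict each other (`score_bounds_incompatible`). Undershooting is the same statement after
reflection.

It remains to choose `h`. In (A), `h = B_n` makes the Hölder bias at most `(log n / B_n)^{1/2}`,
hence at most the risk bound; in (B), `f` is constant on the local interval, so `h` of order `n r₀`
has no bias. -/

lemma pinball_neg (τ x : ℝ) : pinball (1 - τ) (-x) = pinball τ x := by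
  unfold pinball
  rw [max_comm]
  congr 1 <;> ring

lemma totalVar_neg {n : ℕ} (θ : Fin n → ℝ) : totalVar (fun k => -θ k) = totalVar θ := by
  unfold totalVar
  refine Finset.sum_congr rfl fun i _ => ?_
  rw [← abs_neg]
  congr 1
  ring

lemma tvdObjective_neg {n : ℕ} (τ lam : ℝ) (y θ : Fin n → ℝ) :
    tvdObjective (1 - τ) lam (fun k => -y k) (fun k => -θ k) = tvdObjective τ lam y θ := by
  unfold tvdObjective
  rw [totalVar_neg]
  congr 1
  refine Finset.sum_congr rfl fun i _ => ?_
  rw [← pinball_neg τ]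
  congr 1
  ring

/-- Turns lower deviations of the estimate into upper ones, so that only lowering perturbations need
to be analysed. -/
lemma neg_mem_quantileTVD {n : ℕ} {τ lam : ℝ} {y θ : Fin n → ℝ}
    (hθ : θ ∈ quantileTVD τ lam y) :
    (fun k => -θ k) ∈ quantileTVD (1 - τ) lam (fun k => -y k) := by
  intro θ'
  have h := hθ (fun k => -θ' k)
  rw [← tvdObjective_neg τ lam y θ, ← tvdObjective_neg τ lam y] at h
  simpa using h

/-- For small `η`, the pinball loss changes linearly along `x ↦ x + η`. -/
lemma pinball_add_sub {τ x η : ℝ} (hη : 0 ≤ η) (h : x < 0 → η ≤ -x) :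
    pinball τ (x + η) - pinball τ x = η * (τ - if x < 0 then 1 else 0) := by
  unfold pinball
  split_ifs with hx
  · rw [max_eq_right, max_eq_right]
    · ring
    · nlinarith
    · nlinarith [h hx]
  · rw [max_eq_left, max_eq_left]
    · ring
    · nlinarith
    · nlinarith

/-- Effect on the total variation of lowering a vector by `η` on the interval `[s, t]`, when this
decreases the jumps at the two ends of the interval by at least `gl * η` and `gr * η`. -/
lemma totalVar_lower_le {n : ℕ} {θ : Fin n → ℝ} {s t : Fin n} (hst : s ≤ t) {η gl gr : ℝ}
    (hl₀ : (s : ℕ) = 0 → gl = 0)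
    (hl : ∀ j : Fin n, (j : ℕ) + 1 = s → |θ s - η - θ j| ≤ |θ s - θ j| - gl * η)
    (hr₀ : (t : ℕ) + 1 = n → gr = 0)
    (hr : ∀ j : Fin n, (j : ℕ) = t + 1 → |θ j - (θ t - η)| ≤ |θ j - θ t| - gr * η) :
    totalVar (fun k => if k ∈ Finset.Icc s t then θ k - η else θ k) ≤
      totalVar θ - (gl + gr) * η := by
  -- Jump `i` joins entries `i` and `i + 1`, so the ends of the interval are the jumps `s - 1` and
  -- `t`. An end at the boundary of the data has no jump, and its gain is then zero.
  have hsum : ∀ (m : ℕ) (a : ℝ), (m + 1 = n → a = 0) →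
      (n ≤ m → a = 0) → ∑ i : Fin (n - 1), (if (i : ℕ) = m then a else 0) = a := by
    intro m a h1 h2
    by_cases hm : m < n - 1
    · rw [Finset.sum_eq_single (⟨m, hm⟩ : Fin (n - 1))]
      · simp
      · intro b _ hb
        rw [if_neg]
        intro h
        exact hb (Fin.ext h)
      · simp
    · have : a = 0 := by
        rcases Nat.lt_or_ge m n with h | h
        · exact h1 (by omega)
        · exact h2 h
      simp [this]
  have hs := s.isLt
  have ht := t.isLt
  have hst' : (s : ℕ) ≤ t := hst
  have hL : ∑ i : Fin (n - 1), (if (i : ℕ) + 1 = s then gl * η else 0) = gl * η := by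
    by_cases h0 : (s : ℕ) = 0
    · simp [h0, hl₀ h0]
    · refine Eq.trans (Finset.sum_congr rfl fun i _ => ?_)
        (hsum ((s : ℕ) - 1) (gl * η) (by omega) (by omega))
      simp only [show (i : ℕ) + 1 = s ↔ (i : ℕ) = s - 1 by omega]
  have hR : ∑ i : Fin (n - 1), (if (i : ℕ) = t then gr * η else 0) = gr * η :=
    hsum t (gr * η) (fun h => by simp [hr₀ h]) (by omega)
  have key : totalVar (fun k => if k ∈ Finset.Icc s t then θ k - η else θ k) ≤
      ∑ i : Fin (n - 1), (|θ ⟨(i : ℕ) + 1, by omega⟩ - θ ⟨(i : ℕ), by omega⟩|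
        - (if (i : ℕ) + 1 = s then gl * η else 0) - (if (i : ℕ) = t then gr * η else 0)) := by
    unfold totalVar
    refine Finset.sum_le_sum fun i _ => ?_
    have hi := i.isLt
    simp only [Finset.mem_Icc, Fin.le_def]
    by_cases h1 : (i : ℕ) + 1 = s
    · have hs' : (⟨(i : ℕ) + 1, by omega⟩ : Fin n) = s := Fin.ext h1
      rw [if_pos (by omega), if_neg (by omega), if_pos h1, if_neg (by omega), hs', sub_zero]
      exact hl ⟨i, by omega⟩ h1
    by_cases h2 : (i : ℕ) = t
    · have ht' : (⟨(i : ℕ), by omega⟩ : Fin n) = t := Fin.ext h2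
      rw [if_neg (by omega), if_pos (by omega), if_neg h1, if_pos h2, ht', sub_zero]
      exact hr ⟨i + 1, by omega⟩ (by simp [h2])
    rw [if_neg h1, if_neg h2, sub_zero, sub_zero]
    by_cases h3 : (s : ℕ) ≤ i ∧ (i : ℕ) ≤ t
    · rw [if_pos (by omega), if_pos h3]
      refine le_of_eq (congrArg _ ?_)
      ring
    · rw [if_neg (by omega), if_neg h3]
  rw [Finset.sum_sub_distrib, Finset.sum_sub_distrib, hL, hR] at key
  unfold totalVar at key ⊢
  linarith

/-- First-order optimality of a quantile TVD estimate in the direction of an interval. -/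
lemma first_order_of_lower {n : ℕ} {τ lam : ℝ} {y θ : Fin n → ℝ}
    (hθ : θ ∈ quantileTVD τ lam y) (hlam : 0 ≤ lam) {s t : Fin n} (hst : s ≤ t) {η gl gr : ℝ}
    (hη : 0 < η) (hy : ∀ k, y k < θ k → η ≤ θ k - y k)
    (hl₀ : (s : ℕ) = 0 → gl = 0)
    (hl : ∀ j : Fin n, (j : ℕ) + 1 = s → |θ s - η - θ j| ≤ |θ s - θ j| - gl * η)
    (hr₀ : (t : ℕ) + 1 = n → gr = 0)
    (hr : ∀ j : Fin n, (j : ℕ) = t + 1 → |θ j - (θ t - η)| ≤ |θ j - θ t| - gr * η) :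
    lam * (gl + gr) ≤ ∑ k ∈ Finset.Icc s t, (τ - if y k < θ k then 1 else 0) := by
  have hopt := hθ (fun k => if k ∈ Finset.Icc s t then θ k - η else θ k)
  have htv := totalVar_lower_le hst hl₀ hl hr₀ hr
  have hloss : ∑ k, pinball τ (y k - if k ∈ Finset.Icc s t then θ k - η else θ k)
      - ∑ k, pinball τ (y k - θ k) =
      η * ∑ k ∈ Finset.Icc s t, (τ - if y k < θ k then 1 else 0) := by
    rw [← Finset.sum_sub_distrib, Finset.mul_sum,
      ← Finset.sum_subset (Finset.subset_univ (Finset.Icc s t))]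
    · refine Finset.sum_congr rfl fun k hk => ?_
      rw [if_pos hk]
      have := pinball_add_sub (τ := τ) (x := y k - θ k) hη.le
        (fun h => by linarith [hy k (by linarith)])
      rw [show y k - (θ k - η) = y k - θ k + η by ring, this]
      simp only [sub_neg]
    · intro k _ hk
      simp [hk]
  unfold tvdObjective at hopt
  have h1 := mul_le_mul_of_nonneg_left htv hlam
  have : η * (lam * (gl + gr)) ≤
      η * ∑ k ∈ Finset.Icc s t, (τ - if y k < θ k then 1 else 0) := by
    rw [← hloss]
    linarith
  exact le_of_mul_le_mul_left this hη

/-- A point of `p` extends upwards to a run of `p` of length `h`, or to one ending before. -/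
lemma exists_run_above (p : ℕ → Prop) (i h : ℕ) (hp : p i) :
    ∃ t, i ≤ t ∧ t ≤ i + h ∧ (∀ k, i ≤ k → k ≤ t → p k) ∧ (t = i + h ∨ ¬ p (t + 1)) := by
  induction h with
  | zero =>
    refine ⟨i, le_rfl, le_rfl, fun k h1 h2 => ?_, Or.inl rfl⟩
    obtain rfl : k = i := by omega
    exact hp
  | succ h ih =>
    obtain ⟨t, h1, h2, h3, h4⟩ := ih
    by_cases h5 : t = i + h ∧ p (t + 1)
    · refine ⟨t + 1, by omega, by omega, fun k hk1 hk2 => ?_, Or.inl (by omega)⟩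
      rcases Nat.lt_or_ge t k with h | h
      · obtain rfl : k = t + 1 := by omega
        exact h5.2
      · exact h3 k hk1 h
    · exact ⟨t, h1, by omega, h3, Or.inr (by tauto)⟩

/-- A point of `p` extends downwards to a run of `p` of length `h`, or to one ending before. -/
lemma exists_run_below (p : ℕ → Prop) (i h : ℕ) (hp : p i) :
    ∃ s, s ≤ i ∧ i - h ≤ s ∧ (∀ k, s ≤ k → k ≤ i → p k) ∧
      (s = i - h ∨ 0 < s ∧ ¬ p (s - 1)) := by
  induction h with
  | zero =>
    refine ⟨i, le_rfl, by omega, fun k h1 h2 => ?_, Or.inl rfl⟩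
    obtain rfl : k = i := by omega
    exact hp
  | succ h ih =>
    obtain ⟨s, h1, h2, h3, h4⟩ := ih
    -- By truncated subtraction, hitting the left boundary counts as `s = i - (h + 1)`.
    by_cases h0 : s = 0
    · exact ⟨s, h1, by omega, h3, Or.inl (by omega)⟩
    by_cases h5 : s = i - h ∧ p (s - 1)
    · refine ⟨s - 1, by omega, by omega, fun k hk1 hk2 => ?_, Or.inl (by omega)⟩
      rcases Nat.lt_or_ge k s with h | h
      · obtain rfl : k = s - 1 := by omega
        exact h5.2
      · exact h3 k h hk2
    · exact ⟨s, h1, by omega, h3, Or.inr ⟨by omega, by tauto⟩⟩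

/-- The window of radius `h` around `i` lies in the interior of `{0, …, n - 1}`, or `i` is one of
the two end points and the window is one-sided. -/
def IsWindow (n i h : ℕ) : Prop :=
  h < n ∧ ((h < i ∧ i + h + 1 < n) ∨ i = 0 ∨ i + 1 = n)

/-- Around the location `i`, the superlevel set of a quantile TVD estimate at its value in `i`
contains an interval on which either the empirical quantile score is at least `lam`, or which is
long and has score at least `-2 * lam`. -/
lemma exists_interval_score {n : ℕ} {τ lam : ℝ} {y θ : Fin n → ℝ}
    (hθ : θ ∈ quantileTVD τ lam y) (hlam : 0 < lam) {i : Fin n} {h : ℕ} (hw : IsWindow n i h) :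
    ∃ s t : Fin n, s ≤ t ∧ (∀ k ∈ Finset.Icc s t, (i : ℕ) ≤ k + h ∧ (k : ℕ) ≤ i + h) ∧
      (lam ≤ ∑ k ∈ Finset.Icc s t, (τ - if y k < θ i then 1 else 0) ∨
        (h ≤ (Finset.Icc s t).card ∧
          -(2 * lam) ≤ ∑ k ∈ Finset.Icc s t, (τ - if y k < θ i then 1 else 0))) := by
  -- Including `k < n` in `p` makes the upward run stop at the right boundary of the data.
  set p : ℕ → Prop := fun k => ∃ hk : k < n, θ i ≤ θ ⟨k, hk⟩ with hp
  have hpi : p i := ⟨i.isLt, le_rfl⟩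
  obtain ⟨t, hit, hth, htp, ht⟩ := exists_run_above p i h hpi
  obtain ⟨s, hsi, hsh, hsp, hs⟩ := exists_run_below p i h hpi
  have htn : t < n := (htp t hit le_rfl).1
  have hsn : s < n := by omega
  have hall : ∀ k : Fin n, s ≤ k → (k : ℕ) ≤ t → θ i ≤ θ k := by
    intro k h1 h2
    rcases le_total (k : ℕ) i with h3 | h3
    · exact (hsp k h1 h3).2
    · exact (htp k h3 h2).2
  -- a small step size
  obtain ⟨η, hη, hηy, hηv⟩ : ∃ η : ℝ, 0 < η ∧ (∀ k, y k < θ k → η ≤ θ k - y k) ∧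
      (∀ k, θ k < θ i → η ≤ θ i - θ k) := by
    have h1 : ∀ a b : ℝ, ∀ᶠ η in nhdsWithin (0 : ℝ) (Ioi 0), a < b → η ≤ b - a := by
      intro a b
      by_cases hab : a < b
      · filter_upwards [Ioo_mem_nhdsGT (sub_pos.2 hab)] with η hη _ using hη.2.le
      · exact Filter.Eventually.of_forall fun η h => absurd h hab
    have h2 : ∀ᶠ η in nhdsWithin (0 : ℝ) (Ioi 0), ∀ k, y k < θ k → η ≤ θ k - y k :=
      Filter.eventually_all.2 fun k => h1 _ _
    have h3 : ∀ᶠ η in nhdsWithin (0 : ℝ) (Ioi 0), ∀ k, θ k < θ i → η ≤ θ i - θ k :=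
      Filter.eventually_all.2 fun k => h1 _ _
    have h4 : ∀ᶠ η in nhdsWithin (0 : ℝ) (Ioi 0), 0 < η := self_mem_nhdsWithin
    obtain ⟨η, a, b, c⟩ := (h4.and (h2.and h3)).exists
    exact ⟨η, a, b, c⟩
  have hst : (⟨s, hsn⟩ : Fin n) ≤ ⟨t, htn⟩ := by
    simp only [Fin.mk_le_mk]; omega
  -- gains at the two ends
  obtain ⟨gl, hgl₀, hgl, hglv⟩ : ∃ gl : ℝ, (s = 0 → gl = 0) ∧
      (∀ j : Fin n, (j : ℕ) + 1 = s →
        |θ ⟨s, hsn⟩ - η - θ j| ≤ |θ ⟨s, hsn⟩ - θ j| - gl * η) ∧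
      (gl = 1 ∨ (s = 0 ∧ gl = 0) ∨ ((s = i - h ∧ 0 < s) ∧ gl = -1)) := by
    by_cases h0 : s = 0
    · exact ⟨0, fun _ => rfl, fun j hj => by omega, Or.inr (Or.inl ⟨h0, rfl⟩)⟩
    -- If the left neighbour is still in the superlevel set, the window cut the run and the triangle
    -- inequality bounds the loss. Otherwise the neighbour lies below `θ i` by at least `η`, and
    -- lowering shrinks the jump by exactly `η`.
    by_cases h1 : p (s - 1)
    · refine ⟨-1, fun h => absurd h h0, fun j hj => ?_, Or.inr (Or.inr ⟨⟨by tauto, by omega⟩, rfl⟩)⟩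
      rw [show θ ⟨s, hsn⟩ - η - θ j = (θ ⟨s, hsn⟩ - θ j) - η by ring]
      refine (abs_sub _ _).trans ?_
      rw [abs_of_pos hη]
      linarith
    · refine ⟨1, fun h => absurd h h0, fun j hj => ?_, Or.inl rfl⟩
      have h2 : θ j < θ i := by
        by_contra hcon
        refine h1 ⟨by omega, ?_⟩
        rw [not_lt] at hcon
        have hj' : (⟨_, (by omega : s - 1 < n)⟩ : Fin n) = j := Fin.ext (show s - 1 = (j : ℕ) by omega)
        rw [hj']
        exact hcon
      have h3 := hηv j h2
      have h4 := hall ⟨s, hsn⟩ le_rfl (by simp only; omega)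
      rw [abs_of_nonneg (by linarith), abs_of_nonneg (by linarith)]
      linarith
  obtain ⟨gr, hgr₀, hgr, hgrv⟩ : ∃ gr : ℝ, (t + 1 = n → gr = 0) ∧
      (∀ j : Fin n, (j : ℕ) = t + 1 →
        |θ j - (θ ⟨t, htn⟩ - η)| ≤ |θ j - θ ⟨t, htn⟩| - gr * η) ∧
      (gr = 1 ∨ (t + 1 = n ∧ gr = 0) ∨ (t = i + h ∧ gr = -1)) := by
    by_cases h0 : t + 1 = n
    · exact ⟨0, fun _ => rfl, fun j hj => by omega, Or.inr (Or.inl ⟨h0, rfl⟩)⟩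
    by_cases h1 : p (t + 1)
    · refine ⟨-1, fun h => absurd h h0, fun j hj => ?_, Or.inr (Or.inr ⟨by tauto, rfl⟩)⟩
      rw [show θ j - (θ ⟨t, htn⟩ - η) = (θ j - θ ⟨t, htn⟩) + η by ring]
      refine (abs_add_le _ _).trans ?_
      rw [abs_of_pos hη]
      linarith
    · refine ⟨1, fun h => absurd h h0, fun j hj => ?_, Or.inl rfl⟩
      have h2 : θ j < θ i := by
        by_contra hcon
        refine h1 ⟨by omega, ?_⟩
        rw [not_lt] at hcon
        have hj' : (⟨_, (by omega : t + 1 < n)⟩ : Fin n) = j := Fin.ext (show t + 1 = (j : ℕ) by omega)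
        rw [hj']
        exact hcon
      have h3 := hηv j h2
      have h4 := hall ⟨t, htn⟩ (by simp only; omega) le_rfl
      rw [abs_of_nonpos (by linarith), abs_of_nonpos (by linarith)]
      linarith
  have hfo := first_order_of_lower hθ hlam.le hst hη hηy hgl₀ hgl hgr₀ hgr
  -- Since `θ i ≤ θ k` on the run, the threshold can be replaced by one that does not vary with `k`.
  have hmono : ∑ k ∈ Finset.Icc (⟨s, hsn⟩ : Fin n) ⟨t, htn⟩, (τ - if y k < θ k then 1 else 0) ≤
      ∑ k ∈ Finset.Icc (⟨s, hsn⟩ : Fin n) ⟨t, htn⟩, (τ - if y k < θ i then 1 else 0) := by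
    refine Finset.sum_le_sum fun k hk => ?_
    rw [Finset.mem_Icc] at hk
    have := hall k hk.1 hk.2
    split_ifs <;> linarith
  have hfo' := hfo.trans hmono
  refine ⟨⟨s, hsn⟩, ⟨t, htn⟩, hst, fun k hk => ?_, ?_⟩
  · rw [Finset.mem_Icc, Fin.le_def, Fin.le_def] at hk
    simp only at hk
    omega
  rw [Fin.card_Icc]
  simp only
  obtain ⟨hhn, hw⟩ := hw
  have him := i.isLt
  -- Either `gl + gr ≥ 1`, or the run reaches an edge of the window or covers all the data; in the
  -- latter cases it has at least `h` points.
  rcases hglv with rfl | ⟨h1, rfl⟩ | ⟨h1, rfl⟩ <;> rcases hgrv with rfl | ⟨h2, rfl⟩ | ⟨h2, rfl⟩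
  · left; linarith
  · left; linarith
  · right; exact ⟨by omega, by linarith⟩
  · left; linarith
  · right; exact ⟨by omega, by linarith⟩
  · right; exact ⟨by omega, by linarith⟩
  · right; exact ⟨by omega, by linarith⟩
  · right; exact ⟨by omega, by linarith⟩
  · right; exact ⟨by omega, by linarith⟩

/-! ### Uniform deviation of interval sums -/

section Deviation

variable {Ω : Type*} [MeasurableSpace Ω] {P : Measure Ω} [IsProbabilityMeasure P] {n : ℕ}

/-- Hoeffding's inequality for independent random variables with values in `[0, 1]`. -/
lemma measureReal_sum_sub_integral_ge_le {W : Fin n → Ω → ℝ} (hm : ∀ k, Measurable (W k))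
    (hi : iIndepFun W P) (h01 : ∀ k ω, W k ω ∈ Icc (0 : ℝ) 1) (I : Finset (Fin n)) {D : ℝ}
    (hD : 0 ≤ D) :
    P.real {ω | D ≤ ∑ k ∈ I, (W k ω - ∫ ω, W k ω ∂P)} ≤ Real.exp (-(2 * D ^ 2 / I.card)) := by
  have hind : iIndepFun (fun k ω => W k ω - ∫ ω, W k ω ∂P) P :=
    hi.comp (fun k x => x - ∫ ω, W k ω ∂P) fun k => measurable_id.sub_const _
  have h := HasSubgaussianMGF.measure_sum_ge_le_of_iIndepFun hind (s := I)
    (fun k _ => hasSubgaussianMGF_of_mem_Icc (hm k).aemeasurable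
      (Filter.Eventually.of_forall (h01 k))) hD
  refine h.trans_eq ?_
  congr 1
  -- For empty `I` both exponents are `0` because division by zero gives zero.
  rcases Nat.eq_zero_or_pos I.card with h0 | h0
  · simp [h0]
  · have : (I.card : ℝ) ≠ 0 := by positivity
    simp only [sub_zero, nnnorm_one, Finset.sum_const, nsmul_eq_mul]
    push_cast
    field_simp

/-- The event on which the sums over all intervals of `W k - q` are bounded by their mean plus a
deviation of order `(m log n)^{1/2}`, where `m` is the length of the interval. -/
def intervalEvent (c q κ : ℝ) (W : Fin n → Ω → ℝ) : Set Ω :=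
  {ω | ∀ s t : Fin n, s ≤ t → ∑ k ∈ Finset.Icc s t, (W k ω - q) ≤
    -(κ * (Finset.Icc s t).card) +
      Real.sqrt ((c + 2) / 2 * (Finset.Icc s t).card * Real.log n)}

lemma measurableSet_intervalEvent (c q κ : ℝ) {W : Fin n → Ω → ℝ} (hm : ∀ k, Measurable (W k)) :
    MeasurableSet (intervalEvent c q κ W) := by
  have : intervalEvent c q κ W = ⋂ s : Fin n, ⋂ t : Fin n, ⋂ _ : s ≤ t,
      {ω | ∑ k ∈ Finset.Icc s t, (W k ω - q) ≤ -(κ * (Finset.Icc s t).card) +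
        Real.sqrt ((c + 2) / 2 * (Finset.Icc s t).card * Real.log n)} := by
    ext ω
    simp [intervalEvent]
  rw [this]
  refine MeasurableSet.iInter fun s => MeasurableSet.iInter fun t => MeasurableSet.iInter fun _ => ?_
  exact measurableSet_le (Finset.measurable_sum _ fun k _ => (hm k).sub_const _)
    measurable_const

/-- The factor `(c + 2) / 2` makes Hoeffding's bound equal to `n ^ (-(c + 2))` for every interval
length; the union over at most `n ^ 2` intervals uses up the extra `2`. -/
lemma measureReal_compl_intervalEvent_le {c q κ : ℝ} (hc : 0 < c) (hn : 1 < n)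
    {W : Fin n → Ω → ℝ} (hm : ∀ k, Measurable (W k)) (hi : iIndepFun W P)
    (h01 : ∀ k ω, W k ω ∈ Icc (0 : ℝ) 1) (hmean : ∀ k, ∫ ω, W k ω ∂P ≤ q - κ) :
    P.real (intervalEvent c q κ W)ᶜ ≤ (n : ℝ) ^ (-c) := by
  have hn0 : (0 : ℝ) < n := by positivity
  have hlog : 0 < Real.log n := Real.log_pos (by exact_mod_cast hn)
  set D : Fin n × Fin n → ℝ := fun p =>
    Real.sqrt ((c + 2) / 2 * (Finset.Icc p.1 p.2).card * Real.log n) with hD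
  set F : Finset (Fin n × Fin n) := Finset.univ.filter fun p => p.1 ≤ p.2 with hF
  have hsub : (intervalEvent c q κ W)ᶜ ⊆ ⋃ p ∈ F,
      {ω | D p ≤ ∑ k ∈ Finset.Icc p.1 p.2, (W k ω - ∫ ω, W k ω ∂P)} := by
    intro ω hω
    simp only [intervalEvent, mem_compl_iff, mem_ofPred_eq, not_forall, not_le] at hω
    obtain ⟨s, t, hst, hlt⟩ := hω
    simp only [mem_iUnion, mem_ofPred_eq]
    refine ⟨(s, t), by simpa [hF] using hst, ?_⟩
    have h1 : ∑ k ∈ Finset.Icc s t, (W k ω - q) + κ * (Finset.Icc s t).card ≤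
        ∑ k ∈ Finset.Icc s t, (W k ω - ∫ ω, W k ω ∂P) := by
      rw [mul_comm κ, ← nsmul_eq_mul, ← Finset.sum_const, ← Finset.sum_add_distrib]
      exact Finset.sum_le_sum fun k _ => by linarith [hmean k]
    have h2 : D (s, t) ≤ ∑ k ∈ Finset.Icc s t, (W k ω - q) + κ * (Finset.Icc s t).card := by
      simp only [hD]
      linarith
    exact h2.trans h1
  refine (measureReal_mono hsub (measure_ne_top _ _)).trans ?_
  refine (measureReal_biUnion_finset_le F _).trans ?_
  have hterm : ∀ p ∈ F,
      P.real {ω | D p ≤ ∑ k ∈ Finset.Icc p.1 p.2, (W k ω - ∫ ω, W k ω ∂P)} ≤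
        (n : ℝ) ^ (-(c + 2)) := by
    intro p hp
    refine (measureReal_sum_sub_integral_ge_le hm hi h01 _ (Real.sqrt_nonneg _)).trans_eq ?_
    have hp' : p.1 ≤ p.2 := by simpa [hF] using hp
    have hcard : (0 : ℝ) < (Finset.Icc p.1 p.2).card := by
      exact_mod_cast Finset.card_pos.2 (Finset.nonempty_Icc.2 hp')
    rw [Real.rpow_def_of_pos hn0, Real.sq_sqrt (by positivity)]
    congr 1
    field_simp
  refine (Finset.sum_le_card_nsmul F _ _ hterm).trans ?_
  have hcardF : (F.card : ℝ) ≤ (n : ℝ) ^ (2 : ℝ) := by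
    have : F.card ≤ n ^ 2 := (Finset.card_filter_le _ _).trans (by simp [sq])
    rw [Real.rpow_two]
    exact_mod_cast this
  rw [nsmul_eq_mul]
  calc (F.card : ℝ) * (n : ℝ) ^ (-(c + 2)) ≤ (n : ℝ) ^ (2 : ℝ) * (n : ℝ) ^ (-(c + 2)) := by
        gcongr
    _ = (n : ℝ) ^ (-c) := by
        rw [← Real.rpow_add hn0]
        congr 1
        ring

end Deviation

/-! ### Estimation error in terms of the window size -/

/-- An interval with the score required by `exists_interval_score` has a score which exceeds its
mean by more than the deviation bound. -/
lemma score_bounds_incompatible {A c₁ L lam u m h S : ℝ} (hA : 0 < A) (hc₁ : 0 < c₁) (hL : 0 < L)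
    (hlam : 0 < lam) (hm : 0 < m) (hh : 0 < h) (hu : u = (A + 3) / c₁ * (L / lam + lam / h))
    (hS : S ≤ -(c₁ * u * m) + Real.sqrt (A * m * L))
    (hS' : lam ≤ S ∨ h ≤ m ∧ -(2 * lam) ≤ S) : False := by
  have hcu : c₁ * u = (A + 3) * (L / lam) + (A + 3) * (lam / h) := by
    rw [hu]
    field_simp
  have hLl : 0 < L / lam := by positivity
  have hlh : 0 < lam / h := by positivity
  -- By AM-GM, the deviation splits into a part absorbed by the drift `(A + 3) * (L / lam) * m` and
  -- `lam / 2`. On long intervals the remaining drift is at least `3 * lam`, which exceeds `2 * lam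
  -- + lam / 2`.
  have hsq : Real.sqrt (A * m * L) ≤ (A * (L / lam) * m + lam) / 2 := by
    refine Real.sqrt_le_iff.2 ⟨by positivity, ?_⟩
    have : A * m * L = (A * (L / lam) * m) * lam := by field_simp
    rw [this]
    nlinarith [sq_nonneg (A * (L / lam) * m - lam)]
  have h1 : 0 < A * (L / lam) * m := by positivity
  have h2 : 0 < (L / lam) * m := by positivity
  have h3 : 0 < lam / h * m := by positivity
  have h4 : 0 < A * (lam / h * m) := by positivity
  rw [hcu] at hS
  rcases hS' with hS' | ⟨hhm, hS'⟩
  · nlinarith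
  · have h5 : lam ≤ lam / h * m := by
      rw [div_mul_eq_mul_div, le_div_iff₀ hh]
      gcongr
    nlinarith

section ErrorBound

variable {Ω : Type*} [MeasurableSpace Ω] {P : Measure Ω} [IsProbabilityMeasure P] {n : ℕ}

/-- Growth only controls `|F - τ|`; the quantile condition and monotonicity of `F` supply the sign.
-/
lemma cdf_upper_of_growth {τ c₁ δ : ℝ} {ε : Fin n → Ω → ℝ} (hq : QuantileErrors P τ ε)
    (hg : CDFGrowth P τ c₁ δ ε) (k : Fin n) {u : ℝ} (hu : 0 ≤ u) (huδ : u ≤ δ) :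
    τ + c₁ * u ≤ P.real {ω | ε k ω ≤ u} := by
  have hprob : IsProbabilityMeasure (P.map (ε k)) :=
    Measure.isProbabilityMeasure_map (hq.measurable k).aemeasurable
  have h := hg k u (by rwa [abs_of_nonneg hu])
  have h0 : τ ≤ cdf (P.map (ε k)) u := by
    refine (hq.quantile k).2.trans ?_
    rw [cdf_eq_real]
    exact measureReal_mono (Iic_subset_Iic.2 hu)
  rw [abs_of_nonneg hu, abs_of_nonneg (by linarith), cdf_eq_real,
    map_measureReal_apply (hq.measurable k) measurableSet_Iic] at h
  have : {ω | ε k ω ≤ u} = ε k ⁻¹' Iic u := rfl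
  rw [this]
  linarith

lemma cdf_lower_of_growth {τ c₁ δ : ℝ} {ε : Fin n → Ω → ℝ} (hq : QuantileErrors P τ ε)
    (hg : CDFGrowth P τ c₁ δ ε) (k : Fin n) {u : ℝ} (hu : 0 < u) (huδ : u ≤ δ) :
    P.real {ω | ε k ω ≤ -u} ≤ τ - c₁ * u := by
  have hprob : IsProbabilityMeasure (P.map (ε k)) :=
    Measure.isProbabilityMeasure_map (hq.measurable k).aemeasurable
  have h := hg k (-u) (by rwa [abs_neg, abs_of_pos hu])
  have h0 : cdf (P.map (ε k)) (-u) ≤ τ := by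
    refine le_trans ?_ (hq.quantile k).1
    rw [cdf_eq_real]
    exact measureReal_mono (Iic_subset_Iio.2 (by linarith))
  rw [abs_neg, abs_of_pos hu, abs_of_nonpos (by linarith), cdf_eq_real,
    map_measureReal_apply (hq.measurable k) measurableSet_Iic] at h
  have : {ω | ε k ω ≤ -u} = ε k ⁻¹' Iic (-u) := rfl
  rw [this]
  linarith

/-- The estimation error is at most the bias in a window plus the stochastic error. -/
lemma holdsWithProb_errorAtMost {τ c₁ δ c : ℝ} (hc₁ : 0 < c₁) (hc : 1 < c)
    (hn : 1 < n) {ε : Fin n → Ω → ℝ} (hq : QuantileErrors P τ ε) (hg : CDFGrowth P τ c₁ δ ε)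
    {f : ℝ → ℝ} {x₀ lam u b : ℝ} {h : ℕ} (hh : 0 < h) (hlam : 0 < lam)
    (hu : u = ((c + 2) / 2 + 3) / c₁ * (Real.log n / lam + lam / h)) (huδ : u ≤ δ)
    (hw : ∀ i : Fin n, (i : ℕ) + 1 = max 1 ⌊(n : ℝ) * x₀⌋₊ → IsWindow n i h ∧
      ∀ k : Fin n, (i : ℕ) ≤ k + h → (k : ℕ) ≤ i + h → |signal f n k - signal f n i| ≤ b) :
    HoldsWithProb P (1 - 4 * (n : ℝ) ^ (-c)) (errorAtMost τ lam f ε x₀ (b + u)) := by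
  have hn0 : (0 : ℝ) < n := by positivity
  have hlog : 0 < Real.log n := Real.log_pos (by exact_mod_cast hn)
  have hh0 : (0 : ℝ) < h := by exact_mod_cast hh
  have hu0 : 0 < u := by rw [hu]; positivity
  set W₁ : Fin n → Ω → ℝ := fun k ω => (Ioi u).indicator 1 (ε k ω) with hW₁
  set W₂ : Fin n → Ω → ℝ := fun k ω => (Iic (-u)).indicator 1 (ε k ω) with hW₂
  have hind1 : ∀ S : Set ℝ, MeasurableSet S → Measurable (S.indicator (1 : ℝ → ℝ)) := fun S hS =>
    measurable_one.indicator hS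
  have hm1 : ∀ k, Measurable (W₁ k) := fun k => (hind1 _ measurableSet_Ioi).comp (hq.measurable k)
  have hm2 : ∀ k, Measurable (W₂ k) := fun k => (hind1 _ measurableSet_Iic).comp (hq.measurable k)
  have hi1 : iIndepFun W₁ P := hq.indep.comp _ fun _ => hind1 _ measurableSet_Ioi
  have hi2 : iIndepFun W₂ P := hq.indep.comp _ fun _ => hind1 _ measurableSet_Iic
  have h01 : ∀ (S : Set ℝ) (x : ℝ), S.indicator (1 : ℝ → ℝ) x ∈ Icc (0 : ℝ) 1 := by
    intro S x
    by_cases hx : x ∈ S <;> simp [hx]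
  have hint : ∀ (S : Set ℝ), MeasurableSet S → ∀ k,
      ∫ ω, S.indicator (1 : ℝ → ℝ) (ε k ω) ∂P = P.real (ε k ⁻¹' S) := by
    intro S hS k
    rw [← integral_indicator_one (hq.measurable k hS)]
    rfl
  have hE1 : ∀ k, ∫ ω, W₁ k ω ∂P ≤ (1 - τ) - c₁ * u := by
    intro k
    rw [hint _ measurableSet_Ioi]
    have h1 := cdf_upper_of_growth hq hg k hu0.le huδ
    have h2 := probReal_compl_eq_one_sub (μ := P) (hq.measurable k (measurableSet_Iic (a := u)))
    rw [← preimage_compl, compl_Iic] at h2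
    have : {ω | ε k ω ≤ u} = ε k ⁻¹' Iic u := rfl
    rw [this] at h1
    linarith
  have hE2 : ∀ k, ∫ ω, W₂ k ω ∂P ≤ τ - c₁ * u := by
    intro k
    rw [hint _ measurableSet_Iic]
    exact cdf_lower_of_growth hq hg k hu0 huδ
  have hM1 := measurableSet_intervalEvent c (1 - τ) (c₁ * u) hm1
  have hM2 := measurableSet_intervalEvent c τ (c₁ * u) hm2
  refine ⟨intervalEvent c (1 - τ) (c₁ * u) W₁ ∩ intervalEvent c τ (c₁ * u) W₂, hM1.inter hM2,
    ?_, ?_⟩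
  · rintro ω ⟨hω1, hω2⟩ θ hθ i hi
    obtain ⟨hwin, hbias⟩ := hw i hi
    have hcard : ∀ s t : Fin n, s ≤ t → (0 : ℝ) < (Finset.Icc s t).card := by
      intro s t hst
      exact_mod_cast Finset.card_pos.2 (Finset.nonempty_Icc.2 hst)
    by_contra hcon
    rw [not_le, lt_abs] at hcon
    rcases hcon with hcon | hcon
    · obtain ⟨s, t, hst, hJ, hS⟩ := exists_interval_score hθ hlam hwin
      -- In the window, `ε k ω ≤ u` puts the observation at most at `signal f n i + b + u`, hence
      -- strictly below `θ i`.
      have hle : ∑ k ∈ Finset.Icc s t,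
          (τ - if signal f n k + ε k ω < θ i then (1 : ℝ) else 0) ≤
          ∑ k ∈ Finset.Icc s t, (W₁ k ω - (1 - τ)) := by
        refine Finset.sum_le_sum fun k hk => ?_
        obtain ⟨hk1, hk2⟩ := hJ k hk
        have hb := abs_le.1 (hbias k hk1 hk2)
        by_cases hεk : ε k ω ≤ u
        · rw [if_pos (by linarith [hb.2])]
          simp [hW₁, hεk]
        · rw [not_le] at hεk
          simp only [hW₁, indicator_of_mem (mem_Ioi.2 hεk), Pi.one_apply]
          split_ifs <;> linarith
      refine score_bounds_incompatible (by linarith) hc₁ hlog hlam (hcard s t hst) hh0 hu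
        (hle.trans (hω1 s t hst)) (hS.imp id fun h' => ⟨by exact_mod_cast h'.1, h'.2⟩)
    · obtain ⟨s, t, hst, hJ, hS⟩ := exists_interval_score (neg_mem_quantileTVD hθ) hlam hwin
      have hle : ∑ k ∈ Finset.Icc s t,
          ((1 - τ) - if -(signal f n k + ε k ω) < -θ i then (1 : ℝ) else 0) ≤
          ∑ k ∈ Finset.Icc s t, (W₂ k ω - τ) := by
        refine Finset.sum_le_sum fun k hk => ?_
        obtain ⟨hk1, hk2⟩ := hJ k hk
        have hb := abs_le.1 (hbias k hk1 hk2)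
        by_cases hεk : ε k ω ≤ -u
        · simp only [hW₂, indicator_of_mem (mem_Iic.2 hεk), Pi.one_apply]
          split_ifs <;> linarith
        · rw [if_pos (by linarith [hb.1])]
          simp [hW₂, hεk]
      refine score_bounds_incompatible (by linarith) hc₁ hlog hlam (hcard s t hst) hh0 hu
        (hle.trans (hω2 s t hst)) (hS.imp id fun h' => ⟨by exact_mod_cast h'.1, h'.2⟩)
  · have h1 := measureReal_compl_intervalEvent_le (c := c) (by linarith) hn hm1 hi1
      (fun k ω => h01 _ _) hE1
    have h2 := measureReal_compl_intervalEvent_le (c := c) (by linarith) hn hm2 hi2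
      (fun k ω => h01 _ _) hE2
    have h3 := probReal_compl_eq_one_sub (μ := P) (hM1.inter hM2)
    rw [compl_inter] at h3
    have h4 := measureReal_union_le (μ := P) (intervalEvent c (1 - τ) (c₁ * u) W₁)ᶜ
      (intervalEvent c τ (c₁ * u) W₂)ᶜ
    have h5 : (0 : ℝ) ≤ (n : ℝ) ^ (-c) := by positivity
    linarith

end ErrorBound

/-! ### Local intervals and Hölder functions -/

lemma HoldsWithProb.mono {Ω : Type*} [MeasurableSpace Ω] {P : Measure Ω} {p : ℝ} {E F : Set Ω}
    (h : HoldsWithProb P p E) (hEF : E ⊆ F) : HoldsWithProb P p F := by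
  obtain ⟨A, h1, h2, h3⟩ := h
  exact ⟨A, h1, h2.trans hEF, h3⟩

lemma errorAtMost_mono {Ω : Type*} {n : ℕ} {τ lam : ℝ} {f : ℝ → ℝ} {ε : Fin n → Ω → ℝ}
    {x₀ b b' : ℝ} (h : b ≤ b') : errorAtMost τ lam f ε x₀ b ⊆ errorAtMost τ lam f ε x₀ b' :=
  fun _ hω θ hθ i hi => (hω θ hθ i hi).trans h

/-- The design points close to the location belonging to `x₀` lie in the local interval. -/
lemma isWindow_and_mem_localInterval {x₀ r₀ : ℝ} (hx₀ : 0 ≤ x₀) (hr₀ : 0 < r₀)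
    (hsub : localInterval x₀ r₀ ⊆ Icc 0 1) {n h : ℕ} (hn : 4 ≤ n * r₀) (hh : (h : ℝ) ≤ n * r₀ / 4)
    {i : Fin n} (hi : (i : ℕ) + 1 = max 1 ⌊(n : ℝ) * x₀⌋₊) :
    IsWindow n i h ∧ ∀ k : Fin n, (i : ℕ) ≤ k + h → (k : ℕ) ≤ i + h →
      (((k : ℕ) : ℝ) + 1) / n ∈ localInterval x₀ r₀ := by
  have him := i.isLt
  have hn0 : (0 : ℝ) < n := by exact_mod_cast (show 0 < n by omega)
  have cast2 : ∀ {a b c : ℕ}, a ≤ b + c → (a : ℝ) ≤ b + c := fun h => by exact_mod_cast h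
  unfold localInterval at hsub ⊢
  unfold IsWindow
  split_ifs at hsub ⊢ with h0 h1
  · have hr1 : r₀ ≤ 1 := (hsub (right_mem_Icc.2 hr₀.le)).2
    have hi0 : (i : ℕ) = 0 := by simp [h0] at hi; exact hi
    refine ⟨⟨?_, Or.inr (Or.inl hi0)⟩, fun k _ hk => ?_⟩
    · have : (h : ℝ) < n := by nlinarith
      exact_mod_cast this
    · have := cast2 hk
      rw [hi0, Nat.cast_zero] at this
      refine ⟨by positivity, ?_⟩
      rw [div_le_iff₀ hn0]
      linarith
  · have hr1 : 0 ≤ 1 - r₀ := (hsub (left_mem_Icc.2 (by linarith))).1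
    have hi1 : (i : ℕ) + 1 = n := by
      rw [hi, h1, mul_one, Nat.floor_natCast]
      exact max_eq_right (by omega)
    refine ⟨⟨?_, Or.inr (Or.inr hi1)⟩, fun k hk _ => ?_⟩
    · have : (h : ℝ) < n := by nlinarith
      exact_mod_cast this
    · have h2 := cast2 hk
      have h3 : ((i : ℕ) : ℝ) + 1 = n := by exact_mod_cast hi1
      have h4 : ((k : ℕ) : ℝ) + 1 ≤ n := by exact_mod_cast k.isLt
      rw [mem_Icc, div_le_iff₀ hn0, le_div_iff₀ hn0]
      constructor <;> linarith
  · have hl : 0 ≤ x₀ - r₀ := (hsub (left_mem_Icc.2 (by linarith))).1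
    have hr : x₀ + r₀ ≤ 1 := (hsub (right_mem_Icc.2 (by linarith))).2
    have hnx : n * r₀ ≤ n * x₀ := by nlinarith
    have hnx' : n * x₀ ≤ n - n * r₀ := by nlinarith
    have hfl : 1 ≤ ⌊(n : ℝ) * x₀⌋₊ := Nat.one_le_floor_iff _ |>.2 (by linarith)
    rw [max_eq_right hfl] at hi
    have h1 : ((i : ℕ) : ℝ) + 1 ≤ n * x₀ := by
      have := Nat.floor_le (show 0 ≤ (n : ℝ) * x₀ by positivity)
      rw [← hi] at this
      exact_mod_cast this
    have h2 : n * x₀ < ((i : ℕ) : ℝ) + 2 := by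
      have := Nat.lt_floor_add_one ((n : ℝ) * x₀)
      rw [← hi] at this
      push_cast at this
      linarith
    have h3 : (h : ℝ) < (i : ℕ) := by linarith
    have h4 : ((i : ℕ) : ℝ) + h + 1 < n := by linarith
    have h3' : h < (i : ℕ) := by exact_mod_cast h3
    have h4' : (i : ℕ) + h + 1 < n := by exact_mod_cast h4
    refine ⟨⟨by omega, Or.inl ⟨h3', h4'⟩⟩, fun k hk1 hk2 => ?_⟩
    have h5 := cast2 hk1
    have h6 := cast2 hk2
    rw [mem_Icc, div_le_iff₀ hn0, le_div_iff₀ hn0]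
    constructor <;> linarith

/-- A Hölder function with an exponent larger than `1` is constant on preconnected sets. -/
lemma HolderOnWith.eq_of_one_lt {f : ℝ → ℝ} {C r : ℝ≥0} {s : Set ℝ} (hf : HolderOnWith C r f s)
    (hr : 1 < r) (hs : IsPreconnected s) {x y : ℝ} (hx : x ∈ s) (hy : y ∈ s) : f x = f y := by
  have hr0 : 0 < r := zero_lt_one.trans hr
  -- The image has Hausdorff dimension at most `1 / r < 1`, yet it is an interval, and an interval
  -- with two points has dimension `1`.
  have hdim : dimH (f '' s) < 1 := by
    refine (hf.dimH_image_le hr0).trans_lt ?_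
    have h1 : dimH s ≤ 1 := (dimH_mono (subset_univ s)).trans_eq Real.dimH_univ
    rw [ENNReal.div_lt_iff (Or.inl (by exact_mod_cast hr0.ne')) (Or.inl ENNReal.coe_ne_top),
      one_mul]
    exact h1.trans_lt (by exact_mod_cast hr)
  have hconn : OrdConnected (f '' s) :=
    (hs.image f (hf.continuousOn hr0)).ordConnected
  have key : ∀ a ∈ f '' s, ∀ b ∈ f '' s, ¬ a < b := by
    intro a ha b hb hab
    refine hdim.ne ((Real.dimH_of_nonempty_interior ?_).trans (by simp))
    refine ⟨(a + b) / 2, mem_interior.2 ⟨Ioo a b, ?_, isOpen_Ioo, ?_⟩⟩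
    · exact Ioo_subset_Icc_self.trans (hconn.out ha hb)
    · constructor <;> linarith
  have hx' := mem_image_of_mem f hx
  have hy' := mem_image_of_mem f hy
  exact le_antisymm (not_lt.1 (key _ hy' _ hx')) (not_lt.1 (key _ hx' _ hy'))

lemma isPreconnected_localInterval (x₀ r : ℝ) : IsPreconnected (localInterval x₀ r) := by
  unfold localInterval
  split_ifs <;> exact isPreconnected_Icc

lemma abs_signal_sub_le {f : ℝ → ℝ} {α L : ℝ≥0} {S : Set ℝ} (hf : HolderOnWith L α f S) {n h : ℕ}
    {i k : Fin n} (hi : (((i : ℕ) : ℝ) + 1) / n ∈ S) (hk : (((k : ℕ) : ℝ) + 1) / n ∈ S)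
    (h1 : (i : ℕ) ≤ k + h) (h2 : (k : ℕ) ≤ i + h) :
    |signal f n k - signal f n i| ≤ L * ((h : ℝ) / n) ^ (α : ℝ) := by
  have h1' : ((i : ℕ) : ℝ) ≤ (k : ℕ) + h := by exact_mod_cast h1
  have h2' : ((k : ℕ) : ℝ) ≤ (i : ℕ) + h := by exact_mod_cast h2
  refine (Real.dist_eq _ _).symm.trans_le (hf.dist_le_of_le hk hi ?_)
  rw [Real.dist_eq, ← sub_div, abs_div, Nat.abs_cast]
  gcongr
  rw [abs_le]
  constructor <;> linarith

/-! ### The bound as a function of the tuning parameter -/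

lemma riskBound_lamStar {n : ℕ} {B : ℝ} (hB : 0 < B) (hn : 0 < Real.log n) :
    riskBound n B (lamStar n B) = 2 * Real.sqrt (Real.log n / B) := by
  unfold riskBound lamStar
  obtain ⟨b, hb, rfl⟩ : ∃ b, 0 < b ∧ B = b ^ 2 :=
    ⟨Real.sqrt B, Real.sqrt_pos.2 hB, (Real.sq_sqrt hB.le).symm⟩
  obtain ⟨l, hl, hl'⟩ : ∃ l, 0 < l ∧ Real.log n = l ^ 2 :=
    ⟨Real.sqrt (Real.log n), Real.sqrt_pos.2 hn, (Real.sq_sqrt hn.le).symm⟩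
  rw [hl', ← mul_pow, ← div_pow, Real.sqrt_sq (by positivity), Real.sqrt_sq (by positivity)]
  field_simp
  ring

/-- Completing the square exhibits both the minimum and its uniqueness. -/
lemma riskBound_eq {n : ℕ} {B lam : ℝ} (hB : 0 < B) (hn : 0 < Real.log n) (hlam : 0 < lam) :
    riskBound n B lam =
      2 * Real.sqrt (Real.log n / B) + (lam - lamStar n B) ^ 2 / (lam * B) := by
  unfold riskBound lamStar
  obtain ⟨b, hb, rfl⟩ : ∃ b, 0 < b ∧ B = b ^ 2 :=
    ⟨Real.sqrt B, Real.sqrt_pos.2 hB, (Real.sq_sqrt hB.le).symm⟩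
  obtain ⟨l, hl, hl'⟩ : ∃ l, 0 < l ∧ Real.log n = l ^ 2 :=
    ⟨Real.sqrt (Real.log n), Real.sqrt_pos.2 hn, (Real.sq_sqrt hn.le).symm⟩
  rw [hl', ← mul_pow, ← div_pow, Real.sqrt_sq (by positivity), Real.sqrt_sq (by positivity)]
  field_simp
  ring

lemma two_mul_sqrt_le_riskBound {n : ℕ} {B lam : ℝ} (hB : 0 < B) (hn : 0 < Real.log n)
    (hlam : 0 < lam) : 2 * Real.sqrt (Real.log n / B) ≤ riskBound n B lam := by
  rw [riskBound_eq hB hn hlam]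
  have : 0 ≤ (lam - lamStar n B) ^ 2 / (lam * B) := by positivity
  linarith

lemma lamStarOptimal {n : ℕ} {B : ℝ} (hB : 0 < B) (hn : 0 < Real.log n) : LamStarOptimal n B := by
  refine ⟨Real.sqrt_pos.2 (by positivity), fun lam hlam hne => ?_⟩
  rw [riskBound_lamStar hB hn, riskBound_eq hB hn hlam]
  have h1 : lam - lamStar n B ≠ 0 := sub_ne_zero.2 hne
  have : 0 < (lam - lamStar n B) ^ 2 / (lam * B) := by positivity
  linarith

lemma mul_log_le_lamStar {n : ℕ} {B C : ℝ} (hn : 0 < Real.log n)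
    (h : C ^ 2 * Real.log n ≤ B) : C * Real.log n ≤ lamStar n B := by
  refine Real.le_sqrt_of_sq_le ?_
  nlinarith

/-! ### Asymptotics -/

lemma tendsto_log_div_natCast :
    Filter.Tendsto (fun n : ℕ => Real.log n / n) Filter.atTop (nhds 0) :=
  Real.isLittleO_log_id_atTop.tendsto_div_nhds_zero.comp tendsto_natCast_atTop_atTop

lemma eventually_le_natCast (b : ℝ) : ∀ᶠ n : ℕ in Filter.atTop, b ≤ n :=
  tendsto_natCast_atTop_atTop.eventually_ge_atTop b

lemma eventually_mul_log_lt (c : ℝ) : ∀ᶠ n : ℕ in Filter.atTop, c * Real.log n < n := by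
  have h := tendsto_log_div_natCast.const_mul c
  rw [mul_zero] at h
  filter_upwards [h.eventually_lt_const zero_lt_one, eventually_le_natCast 1] with n h1 h2
  have h0 : (0 : ℝ) < n := by linarith
  rw [mul_div, div_lt_one h0] at h1
  exact h1

/-- `n ^ a (log n) ^ b` with `a + b = 1` grows faster than `log n`. -/
lemma eventually_mul_log_lt_rate {a b : ℝ} (ha : 0 < a) (hab : a + b = 1) (c : ℝ) :
    ∀ᶠ n : ℕ in Filter.atTop, c * Real.log n < (n : ℝ) ^ a * Real.log n ^ b := by
  have h := ((tendsto_log_div_natCast.rpow_const (p := a) (Or.inr ha.le))).const_mul c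
  rw [Real.zero_rpow ha.ne', mul_zero] at h
  filter_upwards [h.eventually_lt_const zero_lt_one, eventually_le_natCast 2] with n h1 h2
  have h0 : (0 : ℝ) < n := by linarith
  have hl : 0 < Real.log n := Real.log_pos (by linarith)
  have : Real.log n = Real.log n ^ a * Real.log n ^ b := by
    rw [← Real.rpow_add hl, hab, Real.rpow_one]
  rw [Real.div_rpow hl.le h0.le, mul_div, div_lt_one (by positivity)] at h1
  calc c * Real.log n = c * Real.log n ^ a * Real.log n ^ b := by rw [mul_assoc, ← this]
    _ < _ := by gcongr

/-- `n ^ a (log n) ^ b` with `a + b = 1` grows more slowly than `n`. -/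
lemma eventually_mul_rate_le {a b : ℝ} (hb : 0 < b) (hab : a + b = 1) (c : ℝ) :
    ∀ᶠ n : ℕ in Filter.atTop, c * ((n : ℝ) ^ a * Real.log n ^ b) ≤ n := by
  have h := ((tendsto_log_div_natCast.rpow_const (p := b) (Or.inr hb.le))).const_mul c
  rw [Real.zero_rpow hb.ne', mul_zero] at h
  filter_upwards [h.eventually_lt_const zero_lt_one, eventually_le_natCast 2] with n h1 h2
  have h0 : (0 : ℝ) < n := by linarith
  have hl : 0 < Real.log n := Real.log_pos (by linarith)
  have : (n : ℝ) = (n : ℝ) ^ a * (n : ℝ) ^ b := by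
    rw [← Real.rpow_add h0, hab, Real.rpow_one]
  rw [Real.div_rpow hl.le h0.le, mul_div, div_lt_one (by positivity)] at h1
  calc c * ((n : ℝ) ^ a * Real.log n ^ b) = (n : ℝ) ^ a * (c * Real.log n ^ b) := by ring
    _ ≤ (n : ℝ) ^ a * (n : ℝ) ^ b := by gcongr
    _ = n := this.symm

/-- The bandwidth before rounding balances the bias and the standard deviation. -/
lemma bias_eq_rate {α L N l : ℝ} (hα : 0 < α) (hL : 0 < L) (hN : 0 < N) (hl : 0 < l) :
    L * ((L ^ (-2 / (2 * α + 1)) * N ^ (2 * α / (2 * α + 1)) * l ^ (1 / (2 * α + 1))) / N) ^ α =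
      L ^ (1 / (2 * α + 1)) * N ^ (-α / (2 * α + 1)) * l ^ (α / (2 * α + 1)) := by
  -- In logarithmic coordinates the claim is an identity between exponents.
  obtain ⟨L, rfl⟩ : ∃ x, Real.exp x = L := ⟨_, Real.exp_log hL⟩
  obtain ⟨N, rfl⟩ : ∃ x, Real.exp x = N := ⟨_, Real.exp_log hN⟩
  obtain ⟨l, rfl⟩ : ∃ x, Real.exp x = l := ⟨_, Real.exp_log hl⟩
  simp only [← Real.exp_mul, ← Real.exp_add, ← Real.exp_sub]
  congr 1
  field_simp
  ring

/-- With `bias_eq_rate`: at the unrounded bandwidth `X` the bias bound is exactly `(l / X)^{1/2}`.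
-/
lemma rate_sq {α L N l : ℝ} (hα : 0 < α) (hL : 0 < L) (hN : 0 < N) (hl : 0 < l) :
    (L ^ (1 / (2 * α + 1)) * N ^ (-α / (2 * α + 1)) * l ^ (α / (2 * α + 1))) ^ 2 =
      l / (L ^ (-2 / (2 * α + 1)) * N ^ (2 * α / (2 * α + 1)) * l ^ (1 / (2 * α + 1))) := by
  obtain ⟨L, rfl⟩ : ∃ x, Real.exp x = L := ⟨_, Real.exp_log hL⟩
  obtain ⟨N, rfl⟩ : ∃ x, Real.exp x = N := ⟨_, Real.exp_log hN⟩
  obtain ⟨l, rfl⟩ : ∃ x, Real.exp x = l := ⟨_, Real.exp_log hl⟩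
  simp only [← Real.exp_mul, ← Real.exp_add, ← Real.exp_sub, ← Real.exp_nat_mul]
  congr 1
  push_cast
  field_simp
  ring

/-! ### The theorem -/

/-- Error bound for a window of radius `h`, in terms of a risk bound with parameter `B`. -/
lemma holdsWithProb_errorAtMost_riskBound {Ω : Type*} [MeasurableSpace Ω] {P : Measure Ω}
    [IsProbabilityMeasure P] {n : ℕ} {τ c₁ δ c : ℝ} (hc₁ : 0 < c₁) (hδ : 0 < δ) (hc : 1 < c)
    (hn : 1 < n) {ε : Fin n → Ω → ℝ} (hq : QuantileErrors P τ ε) (hg : CDFGrowth P τ c₁ δ ε)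
    {f : ℝ → ℝ} {x₀ lam b M : ℝ} {h : ℕ} (hh : 0 < h) (hM : M = ((c + 2) / 2 + 3) / c₁)
    (hlam : 2 * M / δ * Real.log n ≤ lam) (hlam' : M * (lam / h) ≤ δ / 2)
    (hw : ∀ i : Fin n, (i : ℕ) + 1 = max 1 ⌊(n : ℝ) * x₀⌋₊ → IsWindow n i h ∧
      ∀ k : Fin n, (i : ℕ) ≤ k + h → (k : ℕ) ≤ i + h → |signal f n k - signal f n i| ≤ b) :
    HoldsWithProb P (1 - 4 * (n : ℝ) ^ (-c))
      (errorAtMost τ lam f ε x₀ (b + M * riskBound n h lam)) := by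
  have hlog : 0 < Real.log n := Real.log_pos (by exact_mod_cast hn)
  have hM0 : 0 < M := by rw [hM]; positivity
  have hlam0 : 0 < lam := lt_of_lt_of_le (by positivity) hlam
  refine holdsWithProb_errorAtMost hc₁ hc hn hq hg hh hlam0 (by rw [hM]; rfl) ?_ hw
  have h1 : M * (Real.log n / lam) ≤ δ / 2 := by
    rw [div_mul_eq_mul_div, div_le_iff₀ hδ] at hlam
    rw [mul_div, div_le_iff₀ hlam0]
    linarith
  unfold riskBound
  linarith

set_option maxHeartbeats 1000000 in
theorem theorem3 (τ c₁ δ c : ℝ) (hτ₀ : 0 < τ) (hτ₁ : τ < 1) (hc₁ : 0 < c₁) (hδ : 0 < δ)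
    (hc : 1 < c) :
    ∃ C C' : ℝ, 0 < C ∧ 0 < C' ∧
      -- Part (A): smoothness `0 < α₀ ≤ 1`
      (∀ α₀ : ℝ≥0, 0 < α₀ → α₀ ≤ 1 →
        ∃ K : ℝ, 0 < K ∧ ∀ L₀ : ℝ≥0, 0 < L₀ → ∃ C'' : ℝ, 0 < C'' ∧
        ∀ x₀ r₀ : ℝ, 0 ≤ x₀ → x₀ ≤ 1 → 0 < r₀ → ∃ N : ℕ, ∀ n : ℕ, N ≤ n →
          (LamStarOptimal n (bandwidth α₀ L₀ n) ∧
            C * Real.log n ≤ lamStar n (bandwidth α₀ L₀ n) ∧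
            lamStar n (bandwidth α₀ L₀ n) <
              C'' * (n : ℝ) ^ (2 * (α₀ : ℝ) / (2 * α₀ + 1)) *
                Real.log n ^ (1 / (2 * (α₀ : ℝ) + 1))) ∧
          ∀ (f : ℝ → ℝ) (Ω : Type*) [MeasurableSpace Ω] (P : Measure Ω) [IsProbabilityMeasure P]
            (ε : Fin n → Ω → ℝ),
            LocallyHolder f x₀ r₀ α₀ L₀ → QuantileErrors P τ ε → CDFGrowth P τ c₁ δ ε →
            (∀ lam : ℝ, C * Real.log n ≤ lam →
              lam < C'' * (n : ℝ) ^ (2 * (α₀ : ℝ) / (2 * α₀ + 1)) *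
                Real.log n ^ (1 / (2 * (α₀ : ℝ) + 1)) →
              HoldsWithProb P (1 - 4 * (n : ℝ) ^ (-c))
                (errorAtMost τ lam f ε x₀ (C' * riskBound n (bandwidth α₀ L₀ n) lam))) ∧
            HoldsWithProb P (1 - 4 * (n : ℝ) ^ (-c))
              (errorAtMost τ (lamStar n (bandwidth α₀ L₀ n)) f ε x₀
                (K * ((2 * (α₀ : ℝ) * L₀) ^ (1 / (2 * (α₀ : ℝ) + 1)) *
                  (n : ℝ) ^ (-(α₀ : ℝ) / (2 * α₀ + 1)) *
                  Real.log n ^ ((α₀ : ℝ) / (2 * α₀ + 1)))))) ∧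
      -- Part (B): smoothness `α₀ > 1`, that is, `f` is locally constant
      (∃ K : ℝ, 0 < K ∧ ∀ r₀ : ℝ, 0 < r₀ → ∃ C''' : ℝ, 0 < C''' ∧
        ∀ x₀ : ℝ, 0 ≤ x₀ → x₀ ≤ 1 → ∃ N : ℕ, ∀ n : ℕ, N ≤ n →
          (LamStarOptimal n (n * r₀) ∧
            C * Real.log n ≤ lamStar n (n * r₀) ∧ lamStar n (n * r₀) < C''' * n) ∧
          ∀ (α₀ L₀ : ℝ≥0) (f : ℝ → ℝ) (Ω : Type*) [MeasurableSpace Ω] (P : Measure Ω)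
            [IsProbabilityMeasure P] (ε : Fin n → Ω → ℝ), 1 < α₀ →
            LocallyHolder f x₀ r₀ α₀ L₀ → QuantileErrors P τ ε → CDFGrowth P τ c₁ δ ε →
            (∀ lam : ℝ, C * Real.log n ≤ lam → lam < C''' * n →
              HoldsWithProb P (1 - 4 * (n : ℝ) ^ (-c))
                (errorAtMost τ lam f ε x₀ (C' * riskBound n (n * r₀) lam))) ∧
            HoldsWithProb P (1 - 4 * (n : ℝ) ^ (-c))
              (errorAtMost τ (lamStar n (n * r₀)) f ε x₀
                (K * Real.sqrt (Real.log n / (n * r₀))))) := by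
  obtain ⟨M, hM⟩ : ∃ M, M = ((c + 2) / 2 + 3) / c₁ := ⟨_, rfl⟩
  have hM0 : 0 < M := by rw [hM]; positivity
  -- The first constant gives `M * (log n / lam) ≤ δ / 2`, half of the requirement `u ≤ δ`. In the
  -- second, `8` is the loss from `h ≥ n * r₀ / 8` in (B) and `1` pays for the bias in (A).
  refine ⟨2 * M / δ, 8 * M + 1, by positivity, by positivity, ?_, ?_⟩
  · intro α₀ hα _
    have hα' : (0 : ℝ) < α₀ := hα
    -- The optimal risk is at most `4 * R` for the rate `R` without the factor `2 * α₀`, which the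
    -- denominator cancels.
    refine ⟨4 * (8 * M + 1) / (2 * (α₀ : ℝ)) ^ (1 / (2 * (α₀ : ℝ) + 1)), by positivity, ?_⟩
    intro L₀ hL
    have hL' : (0 : ℝ) < L₀ := hL
    set ℓ : ℝ := (L₀ : ℝ) ^ (-2 / (2 * (α₀ : ℝ) + 1)) with hℓ
    have hℓ0 : 0 < ℓ := by positivity
    -- Chosen so that `lam < C'' * Y` and `ℓ * Y ≤ 2 * B` give `M * (lam / B) ≤ δ / 2`.
    obtain ⟨C'', hC''⟩ : ∃ C'', C'' = δ * ℓ / (4 * M) := ⟨_, rfl⟩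
    have hC0 : 0 < C'' := by rw [hC'']; positivity
    refine ⟨C'', hC0, ?_⟩
    intro x₀ r₀ hx₀ _ hr₀
    have ha : 0 < 2 * (α₀ : ℝ) / (2 * α₀ + 1) := by positivity
    have hb : 0 < 1 / (2 * (α₀ : ℝ) + 1) := by positivity
    have hab : 2 * (α₀ : ℝ) / (2 * α₀ + 1) + 1 / (2 * (α₀ : ℝ) + 1) = 1 := by
      field_simp
    rw [← Filter.eventually_atTop]
    -- `3 ≤ n` gives `log n ≥ 1`, which absorbs the rounding of `B`. The three rate conditions give
    -- the lower and the upper bound on `lamStar`, and `B ≤ n * r₀ / 4`.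
    filter_upwards [eventually_le_natCast 3, eventually_le_natCast (4 / r₀),
      eventually_mul_log_lt_rate ha hab (2 * ((2 * M / δ) ^ 2 + 1) / ℓ),
      eventually_mul_log_lt_rate ha hab (ℓ / C'' ^ 2),
      eventually_mul_rate_le hb hab (4 * ℓ / r₀)] with n hn3 hnr hY1 hY2 hY3
    set Y : ℝ := (n : ℝ) ^ (2 * (α₀ : ℝ) / (2 * α₀ + 1)) *
      Real.log n ^ (1 / (2 * (α₀ : ℝ) + 1)) with hY
    have hn0 : (0 : ℝ) < n := by linarith
    have hn1 : 1 < n := by exact_mod_cast (show (1 : ℝ) < n by linarith)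
    have hlog1 : 1 ≤ Real.log n := by
      rw [Real.le_log_iff_exp_le hn0]
      exact (Real.exp_one_lt_d9.trans (by norm_num)).le.trans hn3
    have hlog : 0 < Real.log n := by linarith
    have hY0 : 0 < Y := by positivity
    have hC''Y : C'' * (n : ℝ) ^ (2 * (α₀ : ℝ) / (2 * α₀ + 1)) *
        Real.log n ^ (1 / (2 * (α₀ : ℝ) + 1)) = C'' * Y := mul_assoc _ _ _
    rw [hC''Y]
    rw [div_le_iff₀ hr₀] at hnr
    rw [div_mul_eq_mul_div, div_lt_iff₀ hℓ0] at hY1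
    rw [div_mul_eq_mul_div, div_lt_iff₀ (by positivity)] at hY2
    rw [div_mul_eq_mul_div, div_le_iff₀ hr₀] at hY3
    set B : ℕ := bandwidth α₀ L₀ n with hB
    have hBX : B = ⌊ℓ * Y⌋₊ := by
      rw [hB, hY, ← mul_assoc]
      rfl
    have hBle : (B : ℝ) ≤ ℓ * Y := by
      rw [hBX]
      exact Nat.floor_le (by positivity)
    have hBlt : ℓ * Y < B + 1 := by
      rw [hBX]
      exact Nat.lt_floor_add_one _
    have hsq0 : 0 ≤ (2 * M / δ) ^ 2 := by positivity
    have hBlarge : (2 * M / δ) ^ 2 * Real.log n + Real.log n ≤ B := by nlinarith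
    have hBhalf : ℓ * Y ≤ 2 * B := by nlinarith
    have hB0 : (0 : ℝ) < B := by nlinarith
    have hBnat : 0 < B := by exact_mod_cast hB0
    have hlow : 2 * M / δ * Real.log n ≤ lamStar n B :=
      mul_log_le_lamStar hlog (by linarith)
    have hupp : lamStar n B < C'' * Y := by
      refine (Real.sqrt_lt' (by positivity)).2 ?_
      calc (B : ℝ) * Real.log n ≤ ℓ * Y * Real.log n := by gcongr
        _ = (ℓ * Real.log n) * Y := by ring
        _ < (Y * C'' ^ 2) * Y := by gcongr
        _ = (C'' * Y) ^ 2 := by ring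
    refine ⟨⟨lamStarOptimal hB0 hlog, hlow, hupp⟩, ?_⟩
    intro f Ω _ P _ ε hf hq hg
    set R : ℝ := (L₀ : ℝ) ^ (1 / (2 * (α₀ : ℝ) + 1)) * (n : ℝ) ^ (-(α₀ : ℝ) / (2 * α₀ + 1)) *
      Real.log n ^ ((α₀ : ℝ) / (2 * α₀ + 1)) with hR
    have hR0 : 0 < R := by positivity
    have hRbias : (L₀ : ℝ) * (ℓ * Y / n) ^ (α₀ : ℝ) = R := by
      rw [hR, ← bias_eq_rate hα' hL' hn0 hlog, hY, mul_assoc]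
    have hRsq : R ^ 2 = Real.log n / (ℓ * Y) := by
      rw [hR, rate_sq hα' hL' hn0 hlog, hY, mul_assoc]
    have hbias : (L₀ : ℝ) * ((B : ℝ) / n) ^ (α₀ : ℝ) ≤ Real.sqrt (Real.log n / B) := by
      refine le_trans ?_ (Real.le_sqrt_of_sq_le (x := R) ?_)
      · rw [← hRbias]
        gcongr
      · rw [hRsq]
        gcongr
    have hmain : ∀ lam : ℝ, 2 * M / δ * Real.log n ≤ lam → lam < C'' * Y →
        HoldsWithProb P (1 - 4 * (n : ℝ) ^ (-c))
          (errorAtMost τ lam f ε x₀ ((8 * M + 1) * riskBound n B lam)) := by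
      intro lam hlam hlam'
      have hlam0 : 0 < lam := lt_of_lt_of_le (by positivity) hlam
      have hrisk := two_mul_sqrt_le_riskBound hB0 hlog hlam0
      have hsqrt := Real.sqrt_nonneg (Real.log n / B)
      refine (holdsWithProb_errorAtMost_riskBound (b := (L₀ : ℝ) * ((B : ℝ) / n) ^ (α₀ : ℝ))
        hc₁ hδ hc hn1 hq hg hBnat hM hlam ?_ ?_).mono (errorAtMost_mono ?_)
      · have h1 : lam ≤ δ / (2 * M) * B := by
          refine hlam'.le.trans ?_
          calc C'' * Y = δ / (4 * M) * (ℓ * Y) := by rw [hC'']; ring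
            _ ≤ δ / (4 * M) * (2 * B) := by gcongr
            _ = δ / (2 * M) * B := by ring
        calc M * (lam / B) ≤ M * (δ / (2 * M) * B / B) := by gcongr
          _ = δ / 2 := by field_simp
      · intro i hi
        obtain ⟨hw, hmem⟩ := isWindow_and_mem_localInterval hx₀ hr₀ hf.1 hnr
          (h := B) (by linarith) hi
        exact ⟨hw, fun k h1 h2 => abs_signal_sub_le hf.2
          (hmem i (Nat.le_add_right _ _) (Nat.le_add_right _ _)) (hmem k h1 h2) h1 h2⟩
      · have : 0 ≤ M * riskBound n B lam := mul_nonneg hM0.le (by linarith)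
        linarith
    refine ⟨hmain, (hmain _ hlow hupp).mono (errorAtMost_mono ?_)⟩
    rw [riskBound_lamStar hB0 hlog]
    have hsqrt : Real.sqrt (Real.log n / B) ≤ 2 * R := by
      refine Real.sqrt_le_iff.2 ⟨by positivity, ?_⟩
      rw [mul_pow, hRsq, div_le_iff₀ hB0, mul_div, div_mul_eq_mul_div, le_div_iff₀ (by positivity)]
      nlinarith
    rw [Real.mul_rpow (by positivity) hL'.le]
    have h2α : (0 : ℝ) < (2 * (α₀ : ℝ)) ^ (1 / (2 * (α₀ : ℝ) + 1)) := by positivity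
    calc (8 * M + 1) * (2 * Real.sqrt (Real.log n / B)) ≤ (8 * M + 1) * (2 * (2 * R)) := by gcongr
      _ = _ := by rw [hR]; field_simp; ring
  · refine ⟨2 * (8 * M + 1), by positivity, ?_⟩
    intro r₀ hr₀
    -- With `lam / h ≤ 8 * (lam / (n * r₀))` this again yields `M * (lam / h) ≤ δ / 2`.
    obtain ⟨C', hC'⟩ : ∃ C', C' = δ * r₀ / (16 * M) := ⟨_, rfl⟩
    have hC0 : 0 < C' := by rw [hC']; positivity
    refine ⟨C', hC0, ?_⟩
    intro x₀ hx₀ _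
    rw [← Filter.eventually_atTop]
    filter_upwards [eventually_le_natCast 2, eventually_le_natCast (8 / r₀),
      eventually_mul_log_lt ((2 * M / δ) ^ 2 / r₀),
      eventually_mul_log_lt (r₀ / C' ^ 2)] with n hn2 hnr hY1 hY2
    have hn0 : (0 : ℝ) < n := by linarith
    have hn1 : 1 < n := by exact_mod_cast (show (1 : ℝ) < n by linarith)
    have hlog : 0 < Real.log n := Real.log_pos (by linarith)
    rw [div_le_iff₀ hr₀] at hnr
    rw [div_mul_eq_mul_div, div_lt_iff₀ hr₀] at hY1
    rw [div_mul_eq_mul_div, div_lt_iff₀ (by positivity)] at hY2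
    have hB0 : 0 < n * r₀ := by positivity
    have hlow : 2 * M / δ * Real.log n ≤ lamStar n (n * r₀) := mul_log_le_lamStar hlog hY1.le
    have hupp : lamStar n (n * r₀) < C' * n := by
      refine (Real.sqrt_lt' (by positivity)).2 ?_
      calc n * r₀ * Real.log n = n * (r₀ * Real.log n) := by ring
        _ < n * (n * C' ^ 2) := by gcongr
        _ = (C' * n) ^ 2 := by ring
    refine ⟨⟨lamStarOptimal hB0 hlog, hlow, hupp⟩, ?_⟩
    intro α₀ L₀ f Ω _ P _ ε hα hf hq hg
    -- The largest radius allowed by `isWindow_and_mem_localInterval`; `8 ≤ n * r₀` keeps it above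
    -- `n * r₀ / 8` after rounding.
    set h : ℕ := ⌊n * r₀ / 4⌋₊ with hh
    have hle : (h : ℝ) ≤ n * r₀ / 4 := Nat.floor_le (by positivity)
    have hge : n * r₀ / 8 ≤ h := by
      have := Nat.lt_floor_add_one (n * r₀ / 4)
      rw [← hh] at this
      linarith
    have hh0 : (0 : ℝ) < h := by linarith
    have hhnat : 0 < h := by exact_mod_cast hh0
    have hmain : ∀ lam : ℝ, 2 * M / δ * Real.log n ≤ lam → lam < C' * n →
        HoldsWithProb P (1 - 4 * (n : ℝ) ^ (-c))
          (errorAtMost τ lam f ε x₀ ((8 * M + 1) * riskBound n (n * r₀) lam)) := by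
      intro lam hlam hlam'
      have hlam0 : 0 < lam := lt_of_lt_of_le (by positivity) hlam
      have hlh : lam / h ≤ 8 * (lam / (n * r₀)) := by
        calc lam / h ≤ lam / (n * r₀ / 8) := by gcongr
          _ = 8 * (lam / (n * r₀)) := by field_simp
      refine (holdsWithProb_errorAtMost_riskBound (b := 0)
        hc₁ hδ hc hn1 hq hg hhnat hM hlam ?_ ?_).mono (errorAtMost_mono ?_)
      · calc M * (lam / h) ≤ M * (8 * (lam / (n * r₀))) := by gcongr
          _ ≤ M * (8 * (C' * n / (n * r₀))) := by gcongr
          _ = δ / 2 := by rw [hC']; field_simp; norm_num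
      · intro i hi
        obtain ⟨hw, hmem⟩ := isWindow_and_mem_localInterval hx₀ hr₀ hf.1 (by linarith) hle hi
        refine ⟨hw, fun k h1 h2 => ?_⟩
        have : signal f n k = signal f n i :=
          hf.2.eq_of_one_lt hα (isPreconnected_localInterval x₀ r₀) (hmem k h1 h2)
            (hmem i (Nat.le_add_right _ _) (Nat.le_add_right _ _))
        rw [this, sub_self, abs_zero]
      · unfold riskBound
        have h1 : 0 < Real.log n / lam := by positivity
        have h2 : 0 < lam / (n * r₀) := by positivity
        nlinarith
    refine ⟨hmain, (hmain _ hlow hupp).mono (errorAtMost_mono (le_of_eq ?_))⟩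
    rw [riskBound_lamStar hB0 hlog]
    ring
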